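/- Let $\chi$ be the indicator function of the interval $(0,1)$ and let $\{x\}=x-\lfloor x\rfloor$ denote the fractional part of a real number $x$. For every $\varepsilon>0$ there exist an integer $m\ge 1$, real coefficients $c'_1,\dots,c'_m$ and real numbers $\theta_1>0,\dots,\theta_m>0$ such that $$\int_0^\infty\Big(\chi(t)-\sum_{l=1}^m c'_l\Big\{\frac{\theta_l}{t}\Big\}\Big)^2\,dt<\varepsilon .$$ -/

import Mathlib

open MeasureTheory Set Filter Topology
open scoped ContDiff FourierTransform ComplexInnerProductSpace

/-! The substitution t = exp(-u) carries L²(0,∞) isometrically onto L²(ℝ) and turns the dilates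
{θ/t} into multiples of translates of `fractExp`. By Wiener's theorem these translates span a dense
subspace once the Fourier transform of `fractExp` is nonzero almost everywhere. That transform is
the Mellin transform of {1/t} on Re s = 1/2, hence real analytic in ξ; at ξ = 0 it is the integral
of a nonnegative, nonzero function, so its zeros are isolated. -/

/-- The Fourier transform of integrable functions is self-adjoint for the bilinear pairing. -/
theorem integral_fourier_smul_eq_of_integrable {f g : ℝ → ℂ} (hf : Integrable f)
    (hg : Integrable g) : ∫ ξ, 𝓕 f ξ • g ξ = ∫ x, f x • 𝓕 g x := by
  have := VectorFourier.integral_fourierIntegral_smul_eq_flip (L := innerₗ ℝ)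
    Real.continuous_fourierChar continuous_inner hf hg
  rwa [flip_innerₗ] at this

/-- An integrable function whose Fourier transform vanishes is zero almost everywhere. -/
theorem ae_eq_zero_of_fourier_eq_zero {W : ℝ → ℂ} (hW : Integrable W) (h : ∀ y, 𝓕 W y = 0) :
    ∀ᵐ x, W x = 0 := by
  apply ae_eq_zero_of_integral_contDiff_smul_eq_zero hW.locallyIntegrable
  intro g hg hgc
  have hg₁ : HasCompactSupport (Complex.ofRealCLM ∘ g) := hgc.comp_left rfl
  have hg₂ : ContDiff ℝ ∞ (Complex.ofRealCLM ∘ g) := by fun_prop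
  let φ : SchwartzMap ℝ ℂ := hg₁.toSchwartzMap hg₂
  -- Pairing with `𝓕⁻ φ` moves the transform onto `W`, where it vanishes.
  have key := integral_fourier_smul_eq_of_integrable hW
    (𝓕⁻ φ : SchwartzMap ℝ ℂ).integrable
  have h1 : ∀ x, 𝓕 (⇑(𝓕⁻ φ : SchwartzMap ℝ ℂ)) x = (g x : ℂ) := by
    intro x
    rw [← SchwartzMap.fourier_coe, FourierTransform.fourier_fourierInv_eq]
    rfl
  simp only [h, h1, zero_smul, integral_zero] at key
  rw [key]
  refine integral_congr_ae (Eventually.of_forall fun x => ?_)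
  simp [mul_comm]

/-- On `L¹ ∩ L²` the Fourier transform on `L²` is given by the Fourier integral. -/
theorem fourier_toLp_ae_eq {h : ℝ → ℂ} (h1 : Integrable h) (h2 : MemLp h 2) :
    (𝓕 (h2.toLp h) : Lp ℂ 2) =ᵐ[volume] 𝓕 h := by
  have hF : LocallyIntegrable (𝓕 h) :=
    (VectorFourier.fourierIntegral_continuous Real.continuous_fourierChar
      (by exact continuous_inner) h1).locallyIntegrable
  apply ae_eq_of_integral_contDiff_smul_eq ((Lp.memLp _).locallyIntegrable (by norm_num)) hF
  intro g hg hgc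
  have hg₁ : HasCompactSupport (Complex.ofRealCLM ∘ g) := hgc.comp_left rfl
  have hg₂ : ContDiff ℝ ∞ (Complex.ofRealCLM ∘ g) := by fun_prop
  let φ : SchwartzMap ℝ ℂ := hg₁.toSchwartzMap hg₂
  have e1 := congrArg (fun T => T φ) (Lp.fourier_toTemperedDistribution_eq (h2.toLp h))
  simp only [TemperedDistribution.fourier_apply, Lp.toTemperedDistribution_apply] at e1
  have e2 := integral_fourier_smul_eq_of_integrable (f := φ) (g := h) φ.integrable h1
  have e3 : ∫ x, (𝓕 φ) x • (h2.toLp h) x = ∫ x, 𝓕 (⇑φ) x • h x := by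
    apply integral_congr_ae
    filter_upwards [h2.coeFn_toLp] with x hx
    rw [hx, SchwartzMap.fourier_coe]
  exact e1.symm.trans (e3.trans e2)

/-- **Wiener's theorem** in `L²`: the translates of an integrable, square integrable function whose
Fourier transform vanishes almost nowhere span a dense subspace. -/
theorem topologicalClosure_span_translates_eq_top {h : ℝ → ℂ} (h1 : Integrable h)
    (h2 : ∀ y, MemLp (fun u => h (u + y)) 2) (hne : ∀ᵐ ξ, 𝓕 h ξ ≠ 0) :
    (Submodule.span ℂ (range fun y => (h2 y).toLp)).topologicalClosure = ⊤ := by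
  rw [Submodule.topologicalClosure_eq_top_iff, Submodule.eq_bot_iff]
  intro g hg
  have hg' : ∀ y, ⟪(h2 y).toLp, g⟫ = 0 := fun y =>
    (Submodule.mem_orthogonal _ _).1 hg _ (Submodule.subset_span ⟨y, rfl⟩)
  have h20 : MemLp h 2 := by simpa using h2 0
  let H : Lp ℂ 2 (volume : Measure ℝ) := 𝓕 (h20.toLp h)
  let G : Lp ℂ 2 (volume : Measure ℝ) := 𝓕 g
  have hH : H =ᵐ[volume] 𝓕 h := fourier_toLp_ae_eq h1 h20
  have hW : Integrable fun ξ => ⟪H ξ, G ξ⟫ := L2.integrable_inner (𝕜 := ℂ) H G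
  -- By Plancherel, the inner product of `g` with the translate by `y` is the Fourier transform of
  -- `⟪H, G⟫` at `y`.
  have hzero := ae_eq_zero_of_fourier_eq_zero hW fun y => by
    have e := hg' y
    rw [← Lp.inner_fourier_eq, L2.inner_def] at e
    rw [Real.fourier_real_eq, ← e]
    apply integral_congr_ae
    filter_upwards [hH, fourier_toLp_ae_eq (h1.comp_add_right y) (h2 y)] with ξ a b
    have c : 𝓕 (fun u => h (u + y)) ξ = Real.fourierChar (y * ξ) • 𝓕 h ξ :=
      by
      simp only [Real.fourier_real_eq]
      exact congrFun (Fourier.fourierIntegral_comp_add_right Real.fourierChar volume h y) ξ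
    rw [a, b, c, Circle.smul_def, Circle.smul_def, smul_eq_mul, smul_eq_mul]
    simp only [RCLike.inner_apply, map_mul]
    rw [← Circle.coe_inv_eq_conj, ← AddChar.map_neg_eq_inv, mul_comm y]
    ring
  have hG : G = 0 := by
    rw [Lp.eq_zero_iff_ae_eq_zero]
    filter_upwards [hzero, hH, hne] with ξ a b c
    simpa [b, c] using a
  exact (Lp.fourierTransformₗᵢ ℝ ℂ).map_eq_zero_iff.1 hG

/-! ### Logarithmic change of variable -/

theorem image_exp_neg_univ : (fun u : ℝ => Real.exp (-u)) '' univ = Ioi 0 := by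
  ext x
  simp only [image_univ, mem_range, mem_Ioi]
  exact ⟨fun ⟨y, hy⟩ => hy ▸ Real.exp_pos _, fun hx => ⟨-Real.log x, by simp [Real.exp_log hx]⟩⟩

theorem hasDerivWithinAt_exp_neg (u : ℝ) :
    HasDerivWithinAt (fun u : ℝ => Real.exp (-u)) (-Real.exp (-u)) univ u := by
  simpa using! ((hasDerivAt_neg u).exp).hasDerivWithinAt (s := univ)

theorem injOn_exp_neg : InjOn (fun u : ℝ => Real.exp (-u)) univ :=
  fun _ _ _ _ h => neg_injective (Real.exp_injective h)

theorem integrableOn_Ioi_iff_integrable_exp_neg (F : ℝ → ℝ) :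
    IntegrableOn F (Ioi 0) ↔ Integrable fun u => Real.exp (-u) * F (Real.exp (-u)) := by
  rw [← image_exp_neg_univ, integrableOn_image_iff_integrableOn_abs_deriv_smul MeasurableSet.univ
    (fun u _ => hasDerivWithinAt_exp_neg u) injOn_exp_neg]
  simp

theorem integral_Ioi_eq_integral_exp_neg (F : ℝ → ℝ) :
    ∫ t in Ioi 0, F t = ∫ u, Real.exp (-u) * F (Real.exp (-u)) := by
  rw [← image_exp_neg_univ, integral_image_eq_integral_abs_deriv_smul MeasurableSet.univ
    (fun u _ => hasDerivWithinAt_exp_neg u) injOn_exp_neg]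
  simp

/-- The function `t ↦ {1 / t}` in the logarithmic variable `t = exp (-u)`, normalised so that
dilations become translations of `L²(ℝ)`. -/
noncomputable def fractExp (u : ℝ) : ℝ := Real.exp (-u / 2) * Int.fract (Real.exp u)

theorem fractExp_nonneg (u : ℝ) : 0 ≤ fractExp u :=
  mul_nonneg (Real.exp_pos _).le (Int.fract_nonneg _)

theorem fract_le_self {x : ℝ} (hx : 0 ≤ x) : Int.fract x ≤ x := by
  have : (0 : ℝ) ≤ ⌊x⌋ := by exact_mod_cast Int.floor_nonneg.2 hx
  rw [Int.fract]; linarith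

theorem fractExp_le_exp_neg (u : ℝ) : fractExp u ≤ Real.exp (-u / 2) :=
  mul_le_of_le_one_right (Real.exp_pos _).le (Int.fract_lt_one _).le

theorem fractExp_le_exp (u : ℝ) : fractExp u ≤ Real.exp (u / 2) := by
  calc fractExp u ≤ Real.exp (-u / 2) * Real.exp u :=
        mul_le_mul_of_nonneg_left (fract_le_self (Real.exp_pos u).le) (Real.exp_pos _).le
    _ = Real.exp (u / 2) := by rw [← Real.exp_add]; ring_nf

theorem fractExp_le_one (u : ℝ) : fractExp u ≤ 1 := by
  rcases le_total 0 u with hu | hu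
  · exact (fractExp_le_exp_neg u).trans (Real.exp_le_one_iff.2 (by linarith))
  · exact (fractExp_le_exp u).trans (Real.exp_le_one_iff.2 (by linarith))

theorem measurable_fractExp : Measurable fractExp := by
  unfold fractExp; fun_prop

theorem integrable_fractExp : Integrable fractExp := by
  rw [← integrableOn_univ, ← Iic_union_Ioi (a := (0 : ℝ)), integrableOn_union]
  constructor
  · refine Integrable.mono' (g := fun u => Real.exp ((1 / 2) * u))
      (integrableOn_exp_mul_Iic (by norm_num) 0)
      measurable_fractExp.aestronglyMeasurable (Eventually.of_forall fun u => ?_)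
    rw [Real.norm_of_nonneg (fractExp_nonneg u)]
    convert fractExp_le_exp u using 2; ring
  · refine Integrable.mono' (g := fun u => Real.exp ((-1 / 2) * u))
      (integrableOn_exp_mul_Ioi (by norm_num) 0)
      measurable_fractExp.aestronglyMeasurable (Eventually.of_forall fun u => ?_)
    rw [Real.norm_of_nonneg (fractExp_nonneg u)]
    convert fractExp_le_exp_neg u using 2; ring

theorem memLp_two_fractExp : MemLp fractExp 2 := by
  rw [memLp_two_iff_integrable_sq measurable_fractExp.aestronglyMeasurable]
  refine integrable_fractExp.mono' (measurable_fractExp.pow_const 2).aestronglyMeasurable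
    (Eventually.of_forall fun u => ?_)
  rw [Real.norm_of_nonneg (sq_nonneg _)]
  nlinarith [fractExp_nonneg u, fractExp_le_one u]

theorem integral_fractExp_pos : 0 < ∫ u, fractExp u := by
  rw [integral_pos_iff_support_of_nonneg fractExp_nonneg integrable_fractExp]
  refine lt_of_lt_of_le ?_ (measure_mono (s := Ioo (-1 : ℝ) 0) fun u hu => ?_)
  · simp
  · have : Int.fract (Real.exp u) = Real.exp u :=
      Int.fract_eq_self.2 ⟨(Real.exp_pos u).le, Real.exp_lt_one_iff.2 hu.2⟩
    simp [fractExp, this, Real.exp_ne_zero]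

theorem differentiableAt_mellin_fract {s : ℂ} (h0 : 0 < s.re) (h1 : s.re < 1) :
    DifferentiableAt ℂ (mellin fun t : ℝ => ((Int.fract (1 / t) : ℝ) : ℂ)) s := by
  have hm : Measurable fun t : ℝ => ((Int.fract (1 / t) : ℝ) : ℂ) := by fun_prop
  have hb (t : ℝ) : ‖((Int.fract (1 / t) : ℝ) : ℂ)‖ ≤ 1 := by
    rw [Complex.norm_real, Real.norm_of_nonneg (Int.fract_nonneg _)]
    exact (Int.fract_lt_one _).le
  -- The strip comes from {1/t} ≤ 1/t at infinity (`a = 1`) and boundedness near 0 (`b = 0`).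
  refine mellin_differentiableAt_of_isBigO_rpow (a := 1) (b := 0) ?_ ?_ h1 ?_ h0
  · refine LocallyIntegrable.locallyIntegrableOn ?_ _
    exact (locallyIntegrable_const (1 : ℝ)).mono hm.aestronglyMeasurable
      (Eventually.of_forall fun t => by simpa using hb t)
  · refine Asymptotics.IsBigO.of_bound 1 ?_
    filter_upwards [eventually_gt_atTop 0] with t ht
    rw [Complex.norm_real, Real.norm_of_nonneg (Int.fract_nonneg _), Real.rpow_neg_one, one_mul,
      Real.norm_of_nonneg (inv_nonneg.2 ht.le), one_div]
    exact fract_le_self (inv_nonneg.2 ht.le)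
  · refine Asymptotics.IsBigO.of_bound 1 (Eventually.of_forall fun t => ?_)
    simpa using hb t

theorem fourier_fractExp_eq_mellin (ξ : ℝ) :
    𝓕 (fun u => (fractExp u : ℂ)) ξ =
      mellin (fun t : ℝ => ((Int.fract (1 / t) : ℝ) : ℂ)) (1 / 2 + 2 * Real.pi * ξ * Complex.I) := by
  have hre : (1 / 2 + 2 * Real.pi * ξ * Complex.I : ℂ).re = 1 / 2 := by simp
  have him : (1 / 2 + 2 * Real.pi * ξ * Complex.I : ℂ).im = 2 * Real.pi * ξ := by simp
  rw [mellin_eq_fourier, hre, him, mul_div_cancel_left₀ _ (by positivity)]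
  refine congrArg (fun F : ℝ → ℂ => 𝓕 F ξ) (funext fun u => ?_)
  rw [fractExp, Real.exp_neg u, one_div (Real.exp u)⁻¹, inv_inv, Complex.real_smul, Complex.ofReal_mul]
  congr 3
  ring

theorem fourier_fractExp_ne_zero_ae : ∀ᵐ ξ, 𝓕 (fun u => (fractExp u : ℂ)) ξ ≠ 0 := by
  have han : AnalyticOnNhd ℝ (𝓕 (fun u => (fractExp u : ℂ))) univ := by
    intro ξ _
    rw [funext fourier_fractExp_eq_mellin]
    have hstrip : IsOpen {s : ℂ | 0 < s.re ∧ s.re < 1} :=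
      (isOpen_lt continuous_const Complex.continuous_re).inter
        (isOpen_lt Complex.continuous_re continuous_const)
    have hd : DifferentiableOn ℂ (mellin fun t : ℝ => ((Int.fract (1 / t) : ℝ) : ℂ))
        {s : ℂ | 0 < s.re ∧ s.re < 1} :=
      fun s hs => (differentiableAt_mellin_fract hs.1 hs.2).differentiableWithinAt
    have hA := (hd.analyticAt (hstrip.mem_nhds (x := 1 / 2 + 2 * Real.pi * ξ * Complex.I)
      (by constructor <;> norm_num))).restrictScalars (𝕜 := ℝ)
    have hofReal : AnalyticAt ℝ (fun ξ : ℝ => (ξ : ℂ)) ξ := Complex.ofRealCLM.analyticAt ξ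
    have hline : AnalyticAt ℝ (fun ξ : ℝ => (1 / 2 + 2 * Real.pi * ξ * Complex.I : ℂ)) ξ :=
      analyticAt_const.add ((analyticAt_const.mul hofReal).mul analyticAt_const)
    exact hA.comp (f := fun ξ : ℝ => (1 / 2 + 2 * Real.pi * ξ * Complex.I : ℂ)) hline
  have h0 : 𝓕 (fun u => (fractExp u : ℂ)) 0 ≠ 0 := by
    rw [Real.fourier_real_eq]
    simp only [mul_zero, neg_zero, AddChar.map_zero_eq_one, one_smul]
    rw [integral_complex_ofReal]
    exact_mod_cast integral_fractExp_pos.ne'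
  -- A codiscrete set has null complement.
  have := ae_restrict_le_codiscreteWithin (μ := volume) MeasurableSet.univ
    (han.preimage_zero_mem_codiscrete h0)
  rw [Measure.restrict_univ] at this
  exact this

/-! ### Real approximation and return to (0,∞) -/

/-- Real linear combinations of translates of `fractExp` are dense in real `L²(ℝ)`. -/
theorem exists_sum_fractExp_integral_sq_lt {k : ℝ → ℝ} (hk : MemLp k 2) {ε : ℝ} (hε : 0 < ε) :
    ∃ (n : ℕ) (a y : Fin n → ℝ), ∫ u, (k u - ∑ i, a i * fractExp (u + y i)) ^ 2 < ε := by
  have h2 (y : ℝ) : MemLp (fun u => (fractExp (u + y) : ℂ)) 2 :=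
    (memLp_two_fractExp.comp_measurePreserving (measurePreserving_add_right volume y)).ofReal
  have hK : MemLp (fun u => (k u : ℂ)) 2 := hk.ofReal
  have hmem : hK.toLp ∈ (Submodule.span ℂ (range fun y => (h2 y).toLp)).topologicalClosure := by
    rw [topologicalClosure_span_translates_eq_top (h := fun u => (fractExp u : ℂ))
      integrable_fractExp.ofReal h2 fourier_fractExp_ne_zero_ae]
    exact Submodule.mem_top
  obtain ⟨s, hs, hds⟩ := Metric.mem_closure_iff.1 hmem (√ε) (Real.sqrt_pos.2 hε)
  obtain ⟨n, c, g, rfl⟩ := Submodule.mem_span_set'.1 hs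
  choose y hy using fun i => (g i).2
  -- As `k` and `fractExp` are real, taking real parts of the coefficients cannot increase the
  -- error.
  refine ⟨n, fun i => (c i).re, y, ?_⟩
  set s : Lp ℂ 2 (volume : Measure ℝ) := ∑ i, c i • (g i : Lp ℂ 2 (volume : Measure ℝ)) with hsdef
  have hsc : s =ᵐ[volume] fun u => ∑ i, c i * (fractExp (u + y i) : ℂ) := by
    have hterm (i : Fin n) : (c i • (g i : Lp ℂ 2 (volume : Measure ℝ))) =ᵐ[volume]
        fun u => c i * (fractExp (u + y i) : ℂ) := by
      rw [← hy i]
      filter_upwards [Lp.coeFn_smul (c i) (h2 (y i)).toLp, (h2 (y i)).coeFn_toLp] with u h₁ h₂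
      rw [h₁, Pi.smul_apply, h₂, smul_eq_mul]
    rw [hsdef]
    filter_upwards [Lp.coeFn_fun_finsetSum Finset.univ
      fun i => c i • (g i : Lp ℂ 2 (volume : Measure ℝ)), ae_all_iff.2 hterm] with u h₁ h₂
    rw [h₁]
    exact Finset.sum_congr rfl fun i _ => h₂ i
  have hD : ∫ u, ‖(hK.toLp - s) u‖ ^ 2 < ε := by
    have e : (∫ u, ‖(hK.toLp - s) u‖ ^ 2) = ‖hK.toLp - s‖ ^ 2 := by
      have := inner_self_eq_norm_sq_to_K (𝕜 := ℂ) (hK.toLp - s)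
      rw [L2.inner_def] at this
      simp only [inner_self_eq_norm_sq_to_K] at this
      norm_cast at this
    rw [e]
    rw [dist_eq_norm] at hds
    exact (Real.lt_sqrt (norm_nonneg _)).1 hds
  refine lt_of_le_of_lt (integral_mono_of_nonneg (Eventually.of_forall fun u => sq_nonneg _)
    ((memLp_two_iff_integrable_sq_norm (Lp.aestronglyMeasurable _)).1
      (Lp.memLp (hK.toLp - s))) ?_) hD
  filter_upwards [Lp.coeFn_sub hK.toLp s, hK.coeFn_toLp, hsc] with u h₁ h₂ h₃
  rw [h₁, Pi.sub_apply, h₂, h₃, ← sq_abs (k u - _)]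
  refine pow_le_pow_left₀ (abs_nonneg _) ?_ 2
  refine le_trans (le_of_eq ?_) (Complex.abs_re_le_norm _)
  simp

theorem memLp_two_exp_neg_mul_indicator :
    MemLp (fun u => Real.exp (-u / 2) * (Ioo (0 : ℝ) 1).indicator (fun _ => (1 : ℝ))
      (Real.exp (-u))) 2 := by
  have hm : Measurable ((Ioo (0 : ℝ) 1).indicator fun _ => (1 : ℝ)) :=
    measurable_const.indicator measurableSet_Ioo
  have hi : IntegrableOn (fun t => (Ioo (0 : ℝ) 1).indicator (fun _ => (1 : ℝ)) t ^ 2) (Ioi 0) := by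
    have : (fun t => (Ioo (0 : ℝ) 1).indicator (fun _ => (1 : ℝ)) t ^ 2) =
        (Ioo (0 : ℝ) 1).indicator fun _ => (1 : ℝ) := by
      funext t; by_cases h : t ∈ Ioo (0 : ℝ) 1 <;> simp [h]
    rw [this]
    exact ((integrable_indicator_iff measurableSet_Ioo).2
      (integrableOn_const (by simp))).integrableOn
  rw [memLp_two_iff_integrable_sq
    (Measurable.aestronglyMeasurable (by fun_prop))]
  rw [integrableOn_Ioi_iff_integrable_exp_neg] at hi
  refine hi.congr (Eventually.of_forall fun u => ?_)
  simp only [mul_pow]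
  rw [← Real.exp_nat_mul]
  push_cast
  ring_nf

theorem theorem4 (ε : ℝ) (hε : 0 < ε) :
    ∃ m : ℕ, 1 ≤ m ∧ ∃ c θ : Fin m → ℝ, (∀ l, 0 < θ l) ∧
      MeasureTheory.IntegrableOn
        (fun t : ℝ => ((Set.Ioo (0 : ℝ) 1).indicator (fun _ => (1 : ℝ)) t
          - ∑ l, c l * Int.fract (θ l / t)) ^ 2) (Set.Ioi 0) ∧
      ∫ t in Set.Ioi (0 : ℝ), ((Set.Ioo (0 : ℝ) 1).indicator (fun _ => (1 : ℝ)) t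
          - ∑ l, c l * Int.fract (θ l / t)) ^ 2 < ε := by
  obtain ⟨n, a, y, hlt⟩ := exists_sum_fractExp_integral_sq_lt memLp_two_exp_neg_mul_indicator hε
  -- The zero term ensures m ≥ 1 even if n = 0; exp(-y/2) is the weight that `fractExp` gains under
  -- translation by y.
  let c : Fin (n + 1) → ℝ := Fin.cons 0 fun i => a i * Real.exp (-y i / 2)
  let θ : Fin (n + 1) → ℝ := Fin.cons 1 fun i => Real.exp (y i)
  have hsum (u : ℝ) : Real.exp (-u / 2) * ∑ l, c l * Int.fract (θ l / Real.exp (-u)) =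
      ∑ i, a i * fractExp (u + y i) := by
    rw [Fin.sum_univ_succ]
    simp only [c, θ, Fin.cons_zero, Fin.cons_succ, zero_mul, zero_add, Finset.mul_sum]
    refine Finset.sum_congr rfl fun i _ => ?_
    have e₁ : Real.exp (y i) / Real.exp (-u) = Real.exp (u + y i) := by
      rw [← Real.exp_sub]; ring_nf
    have e₂ : Real.exp (-(u + y i) / 2) = Real.exp (-u / 2) * Real.exp (-y i / 2) := by
      rw [← Real.exp_add]; ring_nf
    rw [e₁, fractExp, e₂]
    ring
  have hsq (u : ℝ) : Real.exp (-u) * ((Ioo (0 : ℝ) 1).indicator (fun _ => (1 : ℝ)) (Real.exp (-u))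
        - ∑ l, c l * Int.fract (θ l / Real.exp (-u))) ^ 2 =
      (Real.exp (-u / 2) * (Ioo (0 : ℝ) 1).indicator (fun _ => (1 : ℝ)) (Real.exp (-u))
        - ∑ i, a i * fractExp (u + y i)) ^ 2 := by
    have e : Real.exp (-u) = Real.exp (-u / 2) ^ 2 := by
      rw [← Real.exp_nat_mul]; push_cast; ring_nf
    rw [← hsum, ← mul_sub, mul_pow, ← e]
  refine ⟨n + 1, by omega, c, θ, fun l => ?_, ?_, ?_⟩
  · refine Fin.cases ?_ (fun i => ?_) l
    · simp [θ]
    · simpa [θ] using Real.exp_pos (y i)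
  · rw [integrableOn_Ioi_iff_integrable_exp_neg]
    simp only [hsq]
    refine (memLp_two_exp_neg_mul_indicator.sub (memLp_finsetSum _ fun i _ => ?_)).integrable_sq
    exact (memLp_two_fractExp.comp_measurePreserving
      (measurePreserving_add_right volume (y i))).const_mul (a i)
  · rw [integral_Ioi_eq_integral_exp_neg]
    simpa only [hsq] using hlt
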